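/- Let $n\ge 1$ and $N$ be integers with $N\ge 2n$. A frame for $\mathbb{R}^n$ is a finite sequence of vectors spanning $\mathbb{R}^n$; $(\varphi_i)_{i=1}^N$ is unit norm if $\|\varphi_i\|=1$ for all $i$, and tight if there is $A>0$ with $\sum_{i=1}^N|\langle x,\varphi_i\rangle|^2=A\|x\|^2$ for all $x\in\mathbb{R}^n$. For reals $\lambda_1,\dots,\lambda_n$ let $\mathcal F(N,\{\lambda_j\}_{j=1}^n)$ be the class of unit norm frames $(\varphi_i)_{i=1}^N$ for $\mathbb{R}^n$ whose frame operator $x\mapsto\sum_{i=1}^N\langle x,\varphi_i\rangle\varphi_i$ has eigenvalues $\lambda_1,\dots,\lambda_n$, counted with multiplicity. With respect to an orthonormal basis $(e_j)_{j=1}^n$ of $\mathbb{R}^n$, a frame $(\varphi_i)_{i=1}^N$ is called $k$-sparse if there are sets $J_i\subseteq\{1,\dots,n\}$ with $\varphi_i\in\operatorname{span}\{e_j:j\in J_i\}$ for all $i$ and $\sum_{i=1}^N|J_i|=k$. A frame in a class $\mathcal F$ of frames of $N$ vectors is optimally sparse in $\mathcal F$ if it is $k_1$-sparse for some $k_1$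 such that no frame in $\mathcal F$ is $k_2$-sparse with $k_2<k_1$. The maximal block number $\mu(\lambda_1,\dots,\lambda_n)$ is the maximum, over all permutations $\sigma$ of $\{1,\dots,n\}$, of the number of integers in the set $\{\sum_{j=1}^s\lambda_{\sigma(j)}: s=1,\dots,n\}$. Let $(e_j)_{j=1}^n$ be the standard unit vector basis. The Spectral Tetris algorithm produces $\mathrm{STF}(N;\lambda_1,\dots,\lambda_n)$ as follows. Set $i:=1$. For $j=1,\dots,n$, repeat the following until $\lambda_j=0$: if $\lambda_j<1$, put $\varphi_i:=\sqrt{\lambda_j/2}\,e_j+\sqrt{1-\lambda_j/2}\,e_{j+1}$ and $\varphi_{i+1}:=\sqrt{\lambda_j/2}\,e_j-\sqrt{1-\lambda_j/2}\,e_{j+1}$, then set $i:=i+2$, $\lambda_{j+1}:=\lambda_{j+1}-(2-\lambda_j)$ and $\lambda_j:=0$; otherwise put $\varphi_i:=e_j$, then set $i:=i+1$ and $\lambda_j:=\lambda_j-1$. The output is the sequence of the vectors $\varphi_i$. **Corollary.** For $\lambda_1=\dots=\lambda_n=\frac Nn$ the algorithm terminates after producing exactly $N$ vectors, and its output $\mathrm{STF}(N;\frac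 Nn,\dots,\frac Nn)$ is a unit norm tight frame for $\mathbb{R}^n$. With respect to the standard unit vector basis, it is optimally sparse in the class of all unit norm tight frames of $N$ vectors in $\mathbb{R}^n$, and likewise in $\mathcal F(N,\{\frac Nn\}_{j=1}^n)$. The smallest $k$ for which it is $k$-sparse is $$k=N+2\bigl(n-\gcd(N,n)\bigr),$$ and $\mu\bigl(\frac Nn,\dots,\frac Nn\bigr)=\gcd(N,n)$. -/

import Mathlib

namespace SpectralTetris

/-! ## Frames for `ℝⁿ` -/

section Frames

/-- The finite sequence `φ` is a frame for `ℝⁿ`: it spans `ℝⁿ`. -/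
def IsFrame {n N : ℕ} (φ : Fin N → EuclideanSpace ℝ (Fin n)) : Prop :=
  Submodule.span ℝ (Set.range φ) = ⊤

/-- All vectors of the sequence have norm one. -/
def IsUnitNorm {n N : ℕ} (φ : Fin N → EuclideanSpace ℝ (Fin n)) : Prop :=
  ∀ i, ‖φ i‖ = 1

/-- The sequence is `A`-tight for some frame bound `A > 0`. -/
def IsTight {n N : ℕ} (φ : Fin N → EuclideanSpace ℝ (Fin n)) : Prop :=
  ∃ A : ℝ, 0 < A ∧ ∀ x : EuclideanSpace ℝ (Fin n), ∑ i, |inner ℝ x (φ i)| ^ 2 = A * ‖x‖ ^ 2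

/-- The class of unit norm tight frames of `N` vectors in `ℝⁿ`. -/
def unitNormTightFrames (n N : ℕ) : Set (Fin N → EuclideanSpace ℝ (Fin n)) :=
  {φ | IsFrame φ ∧ IsUnitNorm φ ∧ IsTight φ}

/-- The frame operator `x ↦ ∑ i, ⟨x, φ i⟩ φ i`. -/
noncomputable def frameOperator {n N : ℕ} (φ : Fin N → EuclideanSpace ℝ (Fin n)) :
    EuclideanSpace ℝ (Fin n) →ₗ[ℝ] EuclideanSpace ℝ (Fin n) where
  toFun x := ∑ i, inner ℝ x (φ i) • φ i
  map_add' x y := by simp [inner_add_left, add_smul, Finset.sum_add_distrib]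
  map_smul' c x := by simp [real_inner_smul_left, mul_smul, Finset.smul_sum]

/-- The class `F(N, {lam_j})` of unit norm frames of `N` vectors in `ℝⁿ` whose frame operator has
the eigenvalues `lam_1, …, lam_n`, counted with multiplicity, in any order. -/
def frameClass {n : ℕ} (N : ℕ) (lam : Fin n → ℝ) : Set (Fin N → EuclideanSpace ℝ (Fin n)) :=
  {φ | IsFrame φ ∧ IsUnitNorm φ ∧
    (frameOperator φ).charpoly.roots = (Finset.univ : Finset (Fin n)).val.map lam}

end Frames

/-! ## Sparsity -/

section Sparsity

/-- The sequence `φ` is `k`-sparse with respect to the orthonormal basis `b`: each `φ i` lies in the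
span of the basis vectors with index in some set `J i`, and the sizes of these sets sum to `k`. -/
def IsSparse {n N : ℕ} (b : OrthonormalBasis (Fin n) ℝ (EuclideanSpace ℝ (Fin n))) (k : ℕ)
    (φ : Fin N → EuclideanSpace ℝ (Fin n)) : Prop :=
  ∃ J : Fin N → Finset (Fin n),
    (∀ i, φ i ∈ Submodule.span ℝ (b '' (J i : Set (Fin n)))) ∧ ∑ i, (J i).card = k

/-- `φ` is optimally sparse in the class `F` with respect to the orthonormal basis `b`. -/
def IsOptimallySparse {n N : ℕ} (b : OrthonormalBasis (Fin n) ℝ (EuclideanSpace ℝ (Fin n)))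
    (F : Set (Fin N → EuclideanSpace ℝ (Fin n))) (φ : Fin N → EuclideanSpace ℝ (Fin n)) : Prop :=
  φ ∈ F ∧ ∃ k₁ : ℕ, IsSparse b k₁ φ ∧ ¬ ∃ ψ ∈ F, ∃ k₂ : ℕ, k₂ < k₁ ∧ IsSparse b k₂ ψ

end Sparsity

/-! ## Maximal block number -/

section BlockNumber

/-- The number of integers in the set of partial sums `lam_1 + ⋯ + lam_s`, `s = 1, …, n`. -/
noncomputable def integerPartialSums {n : ℕ} (lam : Fin n → ℝ) : ℕ :=
  {x : ℝ | (∃ s : Fin n, x = ∑ j ∈ Finset.Iic s, lam j) ∧ ∃ z : ℤ, x = z}.ncard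

/-- `lam` is ordered blockwise: no rearrangement has more integers among its partial sums. -/
def OrderedBlockwise {n : ℕ} (lam : Fin n → ℝ) : Prop :=
  ∀ π : Equiv.Perm (Fin n), integerPartialSums (lam ∘ π) ≤ integerPartialSums lam

/-- The maximal block number: the largest number of integers among the partial sums of a
rearrangement of `lam`, that is, the number attained by the rearrangements ordered blockwise (see
`maximalBlockNumber_eq` and `exists_orderedBlockwise`). -/
noncomputable def maximalBlockNumber {n : ℕ} (lam : Fin n → ℝ) : ℕ :=
  (Finset.univ : Finset (Equiv.Perm (Fin n))).sup fun σ => integerPartialSums (lam ∘ σ)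

theorem maximalBlockNumber_eq {n : ℕ} (lam : Fin n → ℝ) (σ : Equiv.Perm (Fin n))
    (h : OrderedBlockwise (lam ∘ σ)) :
    maximalBlockNumber lam = integerPartialSums (lam ∘ σ) := by
  apply le_antisymm
  · refine Finset.sup_le fun τ _ => ?_
    have h1 := h (σ⁻¹ * τ)
    have h2 : (lam ∘ σ) ∘ (σ⁻¹ * τ : Equiv.Perm (Fin n)) = lam ∘ τ := by
      funext i
      simp
    rwa [h2] at h1
  · exact Finset.le_sup (f := fun τ : Equiv.Perm (Fin n) => integerPartialSums (lam ∘ τ))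
      (Finset.mem_univ σ)

theorem exists_orderedBlockwise {n : ℕ} (lam : Fin n → ℝ) :
    ∃ σ : Equiv.Perm (Fin n), OrderedBlockwise (lam ∘ σ) := by
  obtain ⟨σ, hσ⟩ := Finite.exists_max fun σ : Equiv.Perm (Fin n) => integerPartialSums (lam ∘ σ)
  exact ⟨σ, fun π => hσ (σ * π)⟩

end BlockNumber

/-! ## The Spectral Tetris algorithm -/

section Algorithm

/-- The memory of the algorithm. Indices start at `0`: `row` is the current row `j`, `idx` is the
index `i` of the next vector to be written (so `idx` vectors have been written), `lam` holds the
current values of the variables `lam_j`, and `out` the vectors written so far. -/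
structure State (n : ℕ) where
  row : ℕ
  idx : ℕ
  lam : ℕ → ℝ
  out : ℕ → EuclideanSpace ℝ (Fin n)

/-- The standard unit vector `e_j` of `ℝⁿ` (the zero vector if `j` is not a valid index). -/
noncomputable def stdVec (n j : ℕ) : EuclideanSpace ℝ (Fin n) :=
  WithLp.toLp 2 fun k => if (k : ℕ) = j then 1 else 0

/-- The state before the first row is treated. -/
noncomputable def init {n : ℕ} (lam : Fin n → ℝ) : State n where
  row := 0
  idx := 0
  lam j := if h : j < n then lam ⟨j, h⟩ else 0
  out _ := 0

/-- One execution of the body of the `repeat` loop. -/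
noncomputable def body {n : ℕ} (s : State n) : State n :=
  if s.lam s.row < 1 then
    { row := s.row
      idx := s.idx + 2
      lam := Function.update
        (Function.update s.lam (s.row + 1) (s.lam (s.row + 1) - (2 - s.lam s.row))) s.row 0
      out := Function.update
        (Function.update s.out s.idx
          (√(s.lam s.row / 2) • stdVec n s.row + √(1 - s.lam s.row / 2) • stdVec n (s.row + 1)))
        (s.idx + 1)
          (√(s.lam s.row / 2) • stdVec n s.row - √(1 - s.lam s.row / 2) • stdVec n (s.row + 1)) }
  else
    { row := s.row
      idx := s.idx + 1
      lam := Function.update s.lam s.row (s.lam s.row - 1)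
      out := Function.update s.out s.idx (stdVec n s.row) }

/-- One iteration: execute the body of the `repeat` loop and, if the test `until lam_j = 0`
succeeds, move on to the next row. Nothing happens once all `n` rows are done. -/
noncomputable def step {n : ℕ} (s : State n) : State n :=
  if s.row < n then
    if (body s).lam s.row = 0 then { body s with row := s.row + 1 } else body s
  else s

/-- The state after `N` iterations. Each iteration of a running algorithm writes at least one
vector, so `N` iterations are enough whenever the algorithm stops with `N` vectors. -/
noncomputable def finalState {n : ℕ} (N : ℕ) (lam : Fin n → ℝ) : State n :=
  step^[N] (init lam)

/-- The algorithm has treated all `n` rows and has written exactly `N` vectors. -/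
def Terminates {n : ℕ} (N : ℕ) (lam : Fin n → ℝ) : Prop :=
  (finalState N lam).row = n ∧ (finalState N lam).idx = N

/-- The output `STF(N; lam_1, …, lam_n)`. -/
noncomputable def STF {n : ℕ} (N : ℕ) (lam : Fin n → ℝ) : Fin N → EuclideanSpace ℝ (Fin n) :=
  fun i => (finalState N lam).out i

end Algorithm

end SpectralTetris

/-!
Suppose the frame operator of a unit norm frame is diagonal in the orthonormal basis `b` with
eigenvalues `λ j`, and call coordinate `j` of the vectors row `j`. The rows are pairwise
orthogonal, row `j` has square sum `λ j`, and every vector has square sum `1`.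

Lower bound: if every vector is supported either inside or outside a set `S` of rows, then
`∑ j ∈ S, λ j` counts the vectors inside, so it is an integer. Hence, as long as the placed rows
have a non-integral sum, some vector has nonzero entries both in a placed row and in a row `k` not
yet placed; by orthogonality there are at least two such vectors, and `k` is placed next. Each
vector has one entry in the row of its support placed first, and the other entries are those
counted at the steps above, so there are at least `N` plus twice the number of non-integral
partial sums of the placing order.

Upper bound: by taking traces, at any moment of the treatment of row `j` by Spectral Tetris the
number of vectors written so far is `λ 1 + ⋯ + λ j` minus the current value of the variable `λ j`.
So the algorithm writes one pair of `2`-sparse vectors in each row with non-integral partial sum,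
and only `1`-sparse vectors apart from these.

All of the classes in question are the class of unit norm frames with frame operator `(N / n) • id`,
since a unit norm tight frame has frame bound `N / n` by taking traces.
-/

namespace SpectralTetris

open Finset
open scoped InnerProductSpace

section FrameOperator

theorem eq_smul_id_iff_roots_charpoly {𝕜 E : Type*} [RCLike 𝕜] [NormedAddCommGroup E]
    [InnerProductSpace 𝕜 E] [FiniteDimensional 𝕜 E] {T : E →ₗ[𝕜] E} (hT : T.IsSymmetric) (c : 𝕜) :
    T = c • LinearMap.id ↔
      T.charpoly.roots = Multiset.replicate (Module.finrank 𝕜 E) c := by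
  calc
    T = c • LinearMap.id ↔ ∀ i, (hT.eigenvalues rfl i : 𝕜) = c := by
      refine ⟨fun h i => ?_, fun h => (hT.eigenvectorBasis rfl).toBasis.ext fun i => ?_⟩
      · have hv := hT.apply_eigenvectorBasis rfl i
        rw [LinearMap.congr_fun h] at hv
        exact (smul_left_injective 𝕜 ((hT.eigenvectorBasis rfl).orthonormal.ne_zero i) hv).symm
      · simp [h i]
    _ ↔ T.charpoly.roots = Multiset.replicate (Module.finrank 𝕜 E) c := by
      rw [hT.roots_charpoly_eq_eigenvalues rfl, Multiset.eq_replicate]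
      simp

variable {n N : ℕ} (φ : Fin N → EuclideanSpace ℝ (Fin n))

theorem inner_frameOperator_left (x y : EuclideanSpace ℝ (Fin n)) :
    ⟪frameOperator φ x, y⟫_ℝ = ∑ i, ⟪x, φ i⟫_ℝ * ⟪y, φ i⟫_ℝ := by
  simp only [frameOperator, LinearMap.coe_mk, AddHom.coe_mk, sum_inner, real_inner_smul_left,
    real_inner_comm (φ _) y]

theorem isSymmetric_frameOperator : (frameOperator φ).IsSymmetric := fun x y => by
  rw [real_inner_comm _ x, inner_frameOperator_left, inner_frameOperator_left]
  simp only [mul_comm]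

theorem frameOperator_mem_span (x : EuclideanSpace ℝ (Fin n)) :
    frameOperator φ x ∈ Submodule.span ℝ (Set.range φ) := by
  simp only [frameOperator, LinearMap.coe_mk, AddHom.coe_mk]
  exact Submodule.sum_mem _ fun i _ =>
    Submodule.smul_mem _ _ (Submodule.subset_span (Set.mem_range_self i))

theorem frameOperator_eq_smul_id_iff (A : ℝ) :
    frameOperator φ = A • LinearMap.id ↔
      ∀ x : EuclideanSpace ℝ (Fin n), ∑ i, |⟪x, φ i⟫_ℝ| ^ 2 = A * ‖x‖ ^ 2 := by
  have hsymm : (frameOperator φ - A • LinearMap.id).IsSymmetric :=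
    (isSymmetric_frameOperator φ).sub (LinearMap.IsSymmetric.id.smul (by simp))
  rw [← sub_eq_zero, ← hsymm.inner_map_self_eq_zero]
  simp only [LinearMap.sub_apply, LinearMap.smul_apply, LinearMap.id_apply, inner_sub_left,
    inner_frameOperator_left, real_inner_smul_left, real_inner_self_eq_norm_sq, sub_eq_zero,
    sq_abs, ← sq]

end FrameOperator

section EigenbasisFrames

variable {n N : ℕ} {b : OrthonormalBasis (Fin n) ℝ (EuclideanSpace ℝ (Fin n))}
  {φ : Fin N → EuclideanSpace ℝ (Fin n)} {lam : Fin n → ℝ}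

theorem frameOperator_apply_basis_iff :
    (∀ j, frameOperator φ (b j) = lam j • b j) ↔
      ∀ j k, ∑ i, ⟪b j, φ i⟫_ℝ * ⟪b k, φ i⟫_ℝ = if j = k then lam j else 0 := by
  simp only [← inner_frameOperator_left]
  refine forall_congr' fun j => ⟨fun h k => ?_, fun h => InnerProductSpace.ext_inner_right_basis
    b.toBasis fun k => ?_⟩
  · simp [h, real_inner_smul_left, b.inner_eq_ite]
  · simp [h, real_inner_smul_left, b.inner_eq_ite]

theorem sum_inner_sq_eq_eigenvalue (hb : ∀ j, frameOperator φ (b j) = lam j • b j) (j : Fin n) :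
    ∑ i, ⟪b j, φ i⟫_ℝ ^ 2 = lam j := by
  simpa [sq] using frameOperator_apply_basis_iff.1 hb j j

theorem sum_inner_sq_of_norm_eq_one {v : EuclideanSpace ℝ (Fin n)} (hv : ‖v‖ = 1) :
    ∑ j, ⟪b j, v⟫_ℝ ^ 2 = 1 := by
  simpa [hv] using b.sum_sq_norm_inner_right v

theorem sum_eigenvalues (hφ : IsUnitNorm φ) (hb : ∀ j, frameOperator φ (b j) = lam j • b j) :
    ∑ j, lam j = N := by
  simp only [← sum_inner_sq_eq_eigenvalue hb]
  rw [sum_comm]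
  simp [sum_inner_sq_of_norm_eq_one (hφ _)]

theorem isFrame_iff_eigenvalues_pos (hb : ∀ j, frameOperator φ (b j) = lam j • b j) :
    IsFrame φ ↔ ∀ j, 0 < lam j := by
  refine ⟨fun hφ j => ?_, fun hpos => ?_⟩
  · rw [← sum_inner_sq_eq_eigenvalue hb]
    refine (sum_nonneg fun i _ => sq_nonneg _).lt_of_ne' fun hzero => b.orthonormal.ne_zero j ?_
    have hperp : ∀ i, ⟪b j, φ i⟫_ℝ = 0 := by
      simpa using (sum_eq_zero_iff_of_nonneg fun i _ => sq_nonneg _).1 hzero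
    have hspan : Submodule.span ℝ (Set.range φ) ≤ (ℝ ∙ b j)ᗮ :=
      Submodule.span_le.2 (Set.range_subset_iff.2 fun i =>
        Submodule.mem_orthogonal_singleton_iff_inner_right.2 (hperp i))
    rw [← inner_self_eq_zero (𝕜 := ℝ), ← Submodule.mem_orthogonal_singleton_iff_inner_right]
    exact hspan (by rw [hφ]; trivial)
  · rw [IsFrame, eq_top_iff, ← b.toBasis.span_eq, Submodule.span_le, Set.range_subset_iff]
    intro j
    have hj : b j = (lam j)⁻¹ • frameOperator φ (b j) := by
      rw [hb, inv_smul_smul₀ (hpos j).ne']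
    rw [b.coe_toBasis, hj]
    exact Submodule.smul_mem _ _ (frameOperator_mem_span φ _)

/-- The class of unit norm frames of `N` vectors in `ℝⁿ` whose frame operator is diagonal with
respect to the orthonormal basis `b`, the eigenvalue at `b j` being `lam j`. For constant `lam` the
class does not depend on `b` and consists of tight frames. -/
def eigenbasisFrames (b : OrthonormalBasis (Fin n) ℝ (EuclideanSpace ℝ (Fin n))) (N : ℕ)
    (lam : Fin n → ℝ) : Set (Fin N → EuclideanSpace ℝ (Fin n)) :=
  {φ | IsFrame φ ∧ IsUnitNorm φ ∧ ∀ j, frameOperator φ (b j) = lam j • b j}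

theorem frameOperator_apply_basis_const_iff (c : ℝ) :
    (∀ j, frameOperator φ (b j) = c • b j) ↔ frameOperator φ = c • LinearMap.id :=
  ⟨fun h => b.toBasis.ext fun j => by simp [h], fun h => by simp [h]⟩

theorem frameClass_const (b : OrthonormalBasis (Fin n) ℝ (EuclideanSpace ℝ (Fin n))) (N : ℕ)
    (c : ℝ) : frameClass N (fun _ => c) = eigenbasisFrames b N fun _ => c := by
  ext φ
  refine and_congr_right fun _ => and_congr_right fun _ => ?_
  rw [frameOperator_apply_basis_const_iff,
    eq_smul_id_iff_roots_charpoly (isSymmetric_frameOperator φ)]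
  simp

theorem unitNormTightFrames_eq_eigenbasisFrames (hn : n ≠ 0)
    (b : OrthonormalBasis (Fin n) ℝ (EuclideanSpace ℝ (Fin n))) (N : ℕ) :
    unitNormTightFrames n N = eigenbasisFrames b N fun _ => (N : ℝ) / n := by
  ext φ
  refine and_congr_right fun hframe => and_congr_right fun hunit => ⟨?_, fun hb => ?_⟩
  · rintro ⟨A, -, hA⟩
    have hb : ∀ j, frameOperator φ (b j) = A • b j :=
      (frameOperator_apply_basis_const_iff A).2 ((frameOperator_eq_smul_id_iff φ A).2 hA)
    have hsum : n * A = N := by simpa using sum_eigenvalues hunit hb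
    rwa [← hsum, mul_div_cancel_left₀ A (Nat.cast_ne_zero.2 hn)]
  · have : NeZero n := ⟨hn⟩
    exact ⟨N / n, (isFrame_iff_eigenvalues_pos hb).1 hframe 0, (frameOperator_eq_smul_id_iff φ _).1
      ((frameOperator_apply_basis_const_iff _).1 hb)⟩

end EigenbasisFrames

section Sparsity

variable {n N : ℕ}

/-- The indices of the nonzero coordinates of `v` in the orthonormal basis `b`. -/
noncomputable def support (b : OrthonormalBasis (Fin n) ℝ (EuclideanSpace ℝ (Fin n)))
    (v : EuclideanSpace ℝ (Fin n)) : Finset (Fin n) :=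
  {j | ⟪b j, v⟫_ℝ ≠ 0}

/-- The total number of nonzero coordinates of the vectors `φ i` in the orthonormal basis `b`, that
is, the smallest `k` for which `φ` is `k`-sparse (see `isLeast_sparsity`). -/
noncomputable def sparsity (b : OrthonormalBasis (Fin n) ℝ (EuclideanSpace ℝ (Fin n)))
    (φ : Fin N → EuclideanSpace ℝ (Fin n)) : ℕ :=
  ∑ i, #(support b (φ i))

variable (b : OrthonormalBasis (Fin n) ℝ (EuclideanSpace ℝ (Fin n)))

theorem mem_support {v : EuclideanSpace ℝ (Fin n)} {j : Fin n} :
    j ∈ support b v ↔ ⟪b j, v⟫_ℝ ≠ 0 := by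
  simp [support]

theorem mem_span_image_iff_support_subset (v : EuclideanSpace ℝ (Fin n)) (J : Finset (Fin n)) :
    v ∈ Submodule.span ℝ (b '' J) ↔ support b v ⊆ J := by
  rw [← b.coe_toBasis, Module.Basis.mem_span_image]
  simp only [Set.subset_def, Finset.subset_iff, mem_coe, Finsupp.mem_support_iff, mem_support,
    b.coe_toBasis_repr_apply, b.repr_apply_apply]

theorem isLeast_sparsity (φ : Fin N → EuclideanSpace ℝ (Fin n)) :
    IsLeast {k | IsSparse b k φ} (sparsity b φ) := by
  refine ⟨⟨fun i => support b (φ i), fun i => ?_, rfl⟩, ?_⟩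
  · exact (mem_span_image_iff_support_subset b _ _).2 Subset.rfl
  · rintro _ ⟨J, hJ, rfl⟩
    exact sum_le_sum fun i _ => card_le_card ((mem_span_image_iff_support_subset b _ _).1 (hJ i))

theorem isOptimallySparse_of_forall_sparsity_le {F : Set (Fin N → EuclideanSpace ℝ (Fin n))}
    {φ : Fin N → EuclideanSpace ℝ (Fin n)} (hφ : φ ∈ F)
    (hmin : ∀ ψ ∈ F, sparsity b φ ≤ sparsity b ψ) : IsOptimallySparse b F φ := by
  refine ⟨hφ, sparsity b φ, (isLeast_sparsity b φ).1, ?_⟩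
  rintro ⟨ψ, hψ, k, hk, hsparse⟩
  exact hk.not_ge ((hmin ψ hψ).trans ((isLeast_sparsity b ψ).2 hsparse))

end Sparsity

section CutRows

variable {n : ℕ} {lam : Fin n → ℝ}

open scoped Classical in
/-- The indices `s` at which the partial sum of `lam` up to and including `s` is not an integer.
Spectral Tetris writes a pair of `2`-sparse vectors exactly in these rows. -/
noncomputable def cutRows (lam : Fin n → ℝ) : Finset (Fin n) :=
  {s | ¬ ∃ z : ℤ, ∑ j ∈ Iic s, lam j = z}

theorem mem_cutRows {s : Fin n} : s ∈ cutRows lam ↔ ¬ ∃ z : ℤ, ∑ j ∈ Iic s, lam j = z := by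
  simp [cutRows]

theorem strictMono_sum_Iic (hlam : ∀ j, 0 < lam j) :
    StrictMono fun s : Fin n => ∑ j ∈ Iic s, lam j := fun _ t hst =>
  sum_lt_sum_of_subset (Iic_subset_Iic.2 hst.le) (mem_Iic.2 le_rfl) (by simpa using hst) (hlam t)
    fun j _ _ => (hlam j).le

theorem integerPartialSums_eq_card_compl (hlam : ∀ j, 0 < lam j) :
    integerPartialSums lam = #(cutRows lam)ᶜ := by
  rw [← Set.ncard_coe_finset, ← Set.ncard_image_of_injective _ (strictMono_sum_Iic hlam).injective,
    integerPartialSums]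
  congr 1
  ext x
  constructor
  · rintro ⟨⟨s, rfl⟩, hz⟩
    exact ⟨s, by simpa [mem_cutRows] using hz, rfl⟩
  · rintro ⟨s, hs, rfl⟩
    exact ⟨⟨s, rfl⟩, by simpa [mem_cutRows] using hs⟩

theorem card_cutRows (hlam : ∀ j, 0 < lam j) : #(cutRows lam) = n - integerPartialSums lam := by
  rw [integerPartialSums_eq_card_compl hlam, card_compl, Fintype.card_fin,
    Nat.sub_sub_self (card_finset_fin_le _)]

theorem integerPartialSums_le_maximalBlockNumber (σ : Equiv.Perm (Fin n)) :
    integerPartialSums (lam ∘ σ) ≤ maximalBlockNumber lam :=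
  le_sup (f := fun σ : Equiv.Perm (Fin n) => integerPartialSums (lam ∘ σ)) (mem_univ σ)

theorem OrderedBlockwise.maximalBlockNumber_eq (h : OrderedBlockwise lam) :
    maximalBlockNumber lam = integerPartialSums lam :=
  SpectralTetris.maximalBlockNumber_eq lam 1 h

theorem orderedBlockwise_const (c : ℝ) : OrderedBlockwise fun _ : Fin n => c :=
  fun _ => le_rfl

theorem div_gcd_dvd_iff {N : ℕ} (hn : n ≠ 0) (s : ℕ) : n / N.gcd n ∣ s ↔ n ∣ s * N := by
  rw [Nat.div_dvd_iff_dvd_mul (N.gcd_dvd_right n) (Nat.gcd_pos_of_pos_right N (by omega)),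
    N.gcd_comm, Nat.dvd_gcd_mul_iff_dvd_mul, mul_comm]

theorem exists_int_eq_mul_div_iff {N : ℕ} (hn : n ≠ 0) (s : ℕ) :
    (∃ z : ℤ, (s : ℝ) * (N / n) = z) ↔ n ∣ s * N := by
  rw [← Int.natCast_dvd_natCast, dvd_iff_exists_eq_mul_right]
  refine exists_congr fun z => ?_
  rw [← mul_div_assoc, div_eq_iff (Nat.cast_ne_zero.2 hn), mul_comm (z : ℝ)]
  norm_cast

theorem integerPartialSums_const {N : ℕ} (hn : n ≠ 0) (hN : N ≠ 0) :
    integerPartialSums (fun _ : Fin n => (N : ℝ) / n) = N.gcd n := by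
  calc
    integerPartialSums (fun _ : Fin n => (N : ℝ) / n)
        = #{s : Fin n | n / N.gcd n ∣ (s : ℕ) + 1} := by
      rw [integerPartialSums_eq_card_compl fun _ => by positivity]
      congr 1
      ext s
      rw [mem_compl, mem_cutRows, not_not, mem_filter_univ, div_gcd_dvd_iff hn,
        ← exists_int_eq_mul_div_iff hn]
      simp
    _ = #{s ∈ range n | n / N.gcd n ∣ s + 1} := by
      simp only [card_filter]
      exact Fin.sum_univ_eq_sum_range (fun s => if n / N.gcd n ∣ s + 1 then 1 else 0) n
    _ = N.gcd n := by rw [Nat.card_multiples, Nat.div_div_self (N.gcd_dvd_right n) hn]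

end CutRows

section Ordering

theorem exists_injective_forall_Ioi {α : Type*} [Fintype α] [DecidableEq α]
    {R : Finset α → α → Prop} (h : ∀ S ≠ univ, ∃ a ∉ S, R S a) {m : ℕ}
    (hm : m ≤ Fintype.card α) :
    ∃ f : Fin m → α, f.Injective ∧ ∀ k, R ((Ioi k).image f) (f k) := by
  induction m with
  | zero => exact ⟨Fin.elim0, fun k => k.elim0, fun k => k.elim0⟩
  | succ m ih =>
    obtain ⟨f, hf, hR⟩ := ih (by omega)
    have hne : univ.image f ≠ univ := fun heq => by
      have hcard := congrArg card heq
      rw [card_image_of_injective _ hf, card_univ, card_univ, Fintype.card_fin] at hcard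
      omega
    obtain ⟨a, ha, hRa⟩ := h _ hne
    refine ⟨Fin.cons a f, Fin.cons_injective_iff.2 ⟨by simpa using ha, hf⟩, Fin.cases ?_ ?_⟩
    · rw [Fin.Ioi_zero_eq_map, map_eq_image, image_image]
      exact hRa
    · intro k
      rw [← Fin.map_succEmb_Ioi, map_eq_image, image_image]
      exact hR k

theorem exists_equiv_forall_Ioi {α : Type*} [Fintype α] [DecidableEq α] {n : ℕ}
    (hα : Fintype.card α = n) {R : Finset α → α → Prop} (h : ∀ S ≠ univ, ∃ a ∉ S, R S a) :
    ∃ σ : Fin n ≃ α, ∀ k, R ((Ioi k).image σ) (σ k) := by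
  obtain ⟨f, hf, hR⟩ := exists_injective_forall_Ioi h hα.ge
  have hbij : f.Bijective :=
    (Fintype.bijective_iff_injective_and_card f).2 ⟨hf, by simp [hα]⟩
  exact ⟨Equiv.ofBijective f hbij, hR⟩

theorem card_filter_exists_lt_add_one {α : Type*} [LinearOrder α] {T : Finset α}
    (hT : T.Nonempty) : #{k ∈ T | ∃ l ∈ T, k < l} + 1 = #T := by
  have herase : {k ∈ T | ∃ l ∈ T, k < l} = T.erase (T.max' hT) := by
    ext k
    rw [mem_filter, mem_erase, and_comm]
    refine and_congr_left fun hk => ⟨?_, fun hne => ?_⟩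
    · rintro ⟨l, hl, hkl⟩
      exact (hkl.trans_le (T.le_max' l hl)).ne
    · exact ⟨T.max' hT, T.max'_mem hT, (T.le_max' k hk).lt_of_ne hne⟩
  rw [herase, card_erase_add_one (T.max'_mem hT)]

theorem card_add_sum_card_filter_exists_lt {ι α : Type*} [Fintype ι] [Fintype α] [LinearOrder α]
    {T : ι → Finset α} (hT : ∀ i, (T i).Nonempty) :
    Fintype.card ι + ∑ k, #{i | k ∈ T i ∧ ∃ l ∈ T i, k < l} = ∑ i, #(T i) := by
  have hswap : ∑ k, #{i | k ∈ T i ∧ ∃ l ∈ T i, k < l} = ∑ i, #{k ∈ T i | ∃ l ∈ T i, k < l} :=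
    (sum_card_bipartiteAbove_eq_sum_card_bipartiteBelow _).trans <| by
      simp [bipartiteBelow, ← filter_filter]
  rw [hswap, ← sum_congr rfl fun i _ => card_filter_exists_lt_add_one (hT i), sum_add_distrib,
    add_comm, sum_const, smul_eq_mul, mul_one, card_univ]

end Ordering

section LowerBound

variable {n N : ℕ} {b : OrthonormalBasis (Fin n) ℝ (EuclideanSpace ℝ (Fin n))}
  {φ : Fin N → EuclideanSpace ℝ (Fin n)} {lam : Fin n → ℝ}

theorem support_nonempty_of_norm_eq_one {v : EuclideanSpace ℝ (Fin n)} (hv : ‖v‖ = 1) :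
    (support b v).Nonempty := by
  rw [nonempty_iff_ne_empty]
  intro hempty
  have hzero : ∀ j, ⟪b j, v⟫_ℝ = 0 := fun j => by
    simpa [hempty] using (mem_support b (v := v) (j := j)).not
  simpa [hzero] using sum_inner_sq_of_norm_eq_one (b := b) hv

theorem sum_eigenvalues_eq_card_of_support_subset_or_disjoint (hφ : IsUnitNorm φ)
    (hb : ∀ j, frameOperator φ (b j) = lam j • b j) {S : Finset (Fin n)}
    (hS : ∀ i, support b (φ i) ⊆ S ∨ Disjoint (support b (φ i)) S) :
    ∑ j ∈ S, lam j = #{i | support b (φ i) ⊆ S} := by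
  calc
    ∑ j ∈ S, lam j = ∑ i, ∑ j ∈ S, ⟪b j, φ i⟫_ℝ ^ 2 := by
      rw [sum_comm]
      simp only [sum_inner_sq_eq_eigenvalue hb]
    _ = ∑ i, if support b (φ i) ⊆ S then 1 else 0 := by
      refine sum_congr rfl fun i _ => ?_
      split_ifs with hi
      · rw [← sum_inner_sq_of_norm_eq_one (b := b) (hφ i)]
        refine sum_subset (subset_univ S) fun j _ hj => ?_
        simpa [mem_support] using fun hmem => hj (hi hmem)
      · refine sum_eq_zero fun j hj => ?_
        simpa [mem_support] using disjoint_right.1 ((hS i).resolve_left hi) hj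
    _ = #{i | support b (φ i) ⊆ S} := sum_boole _ _

theorem two_le_card_filter_mem_support (hb : ∀ j, frameOperator φ (b j) = lam j • b j)
    {j k : Fin n} (hjk : j ≠ k) {i : Fin N} (hj : j ∈ support b (φ i))
    (hk : k ∈ support b (φ i)) :
    2 ≤ #{i | j ∈ support b (φ i) ∧ k ∈ support b (φ i)} := by
  have horth : ∑ i, ⟪b j, φ i⟫_ℝ * ⟪b k, φ i⟫_ℝ = 0 := by
    simpa [hjk] using frameOperator_apply_basis_iff.1 hb j k
  rw [mem_support] at hj hk
  obtain ⟨i', hne, hi'⟩ : ∃ i' ≠ i, ⟪b j, φ i'⟫_ℝ * ⟪b k, φ i'⟫_ℝ ≠ 0 := by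
    by_contra! hzero
    rw [sum_eq_single i (fun i' _ hne => hzero i' hne) (by simp)] at horth
    exact mul_ne_zero hj hk horth
  exact one_lt_card.2 ⟨i, by simp [mem_support, hj, hk], i',
    by simpa [mem_support] using mul_ne_zero_iff.1 hi', hne.symm⟩

theorem exists_notMem_two_le_card (hφ : IsUnitNorm φ)
    (hb : ∀ j, frameOperator φ (b j) = lam j • b j) {S : Finset (Fin n)}
    (hS : ¬ ∃ z : ℤ, ∑ j ∈ S, lam j = z) :
    ∃ k ∉ S, 2 ≤ #{i | k ∈ support b (φ i) ∧ ∃ j ∈ S, j ∈ support b (φ i)} := by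
  obtain ⟨i, hsub, hdisj⟩ :
      ∃ i, ¬ support b (φ i) ⊆ S ∧ ¬ Disjoint (support b (φ i)) S := by
    by_contra! hclosed
    exact hS ⟨_, (sum_eigenvalues_eq_card_of_support_subset_or_disjoint hφ hb fun i =>
      or_iff_not_imp_left.2 (hclosed i)).trans (Int.cast_natCast _).symm⟩
  obtain ⟨k, hk, hkS⟩ := not_subset.1 hsub
  obtain ⟨j, hj, hjS⟩ := not_disjoint_iff.1 hdisj
  have hkj : k ≠ j := fun h => hkS (h ▸ hjS)
  refine ⟨k, hkS, (two_le_card_filter_mem_support hb hkj hk hj).trans (card_le_card ?_)⟩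
  exact monotone_filter_right _ fun i _ h => ⟨h.1, j, hjS, h.2⟩

theorem exists_perm_forall_cutRows_two_le_card (hφ : IsUnitNorm φ)
    (hb : ∀ j, frameOperator φ (b j) = lam j • b j) :
    ∃ σ : Equiv.Perm (Fin n), ∀ k ∈ cutRows (lam ∘ σ),
      2 ≤ #{i | σ k ∈ support b (φ i) ∧ ∃ l > k, σ l ∈ support b (φ i)} := by
  obtain ⟨σ, hσ⟩ := exists_equiv_forall_Ioi (Fintype.card_fin n)
      (R := fun S k => (¬ ∃ z : ℤ, ∑ j ∈ S, lam j = z) →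
        2 ≤ #{i | k ∈ support b (φ i) ∧ ∃ j ∈ S, j ∈ support b (φ i)}) fun S hS => by
    by_cases hint : ∃ z : ℤ, ∑ j ∈ S, lam j = z
    · exact (not_forall_not.1 fun h => hS (eq_univ_of_forall fun k => not_not.1 (h k))).imp
        fun k hk => ⟨hk, fun h => absurd hint h⟩
    · exact (exists_notMem_two_le_card hφ hb hint).imp fun k hk => ⟨hk.1, fun _ => hk.2⟩
  refine ⟨σ, fun k hk => ?_⟩
  have hcompl : (Iic k)ᶜ = Ioi k := by
    ext
    simp
  have hsplit : ∑ j ∈ Iic k, lam (σ j) + ∑ j ∈ Ioi k, lam (σ j) = N := by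
    rw [← sum_eigenvalues hφ hb, ← Equiv.sum_comp σ, ← sum_add_sum_compl (Iic k), hcompl]
  have hcut : ¬ ∃ z : ℤ, ∑ j ∈ (Ioi k).image σ, lam j = z := by
    rintro ⟨z, hz⟩
    rw [sum_image σ.injective.injOn] at hz
    exact mem_cutRows.1 hk ⟨N - z, by push_cast; exact eq_sub_of_add_eq (hz ▸ hsplit)⟩
  simpa using hσ k hcut

theorem add_two_mul_sub_maximalBlockNumber_le_sparsity (hφ : φ ∈ eigenbasisFrames b N lam) :
    N + 2 * (n - maximalBlockNumber lam) ≤ sparsity b φ := by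
  obtain ⟨hframe, hunit, hb⟩ := hφ
  obtain ⟨σ, hσ⟩ := exists_perm_forall_cutRows_two_le_card hunit hb
  calc
    N + 2 * (n - maximalBlockNumber lam) ≤ N + 2 * (n - integerPartialSums (lam ∘ σ)) := by
      gcongr
      exact integerPartialSums_le_maximalBlockNumber σ
    _ = N + ∑ _k ∈ cutRows (lam ∘ σ), 2 := by
      have hpos (j : Fin n) : 0 < (lam ∘ σ) j := (isFrame_iff_eigenvalues_pos hb).1 hframe (σ j)
      rw [← card_cutRows hpos, sum_const, smul_eq_mul, mul_comm]
    _ ≤ N + ∑ k, #{i | σ k ∈ support b (φ i) ∧ ∃ l > k, σ l ∈ support b (φ i)} := by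
      gcongr
      exact (sum_le_sum hσ).trans (sum_le_univ_sum_of_nonneg fun _ => Nat.zero_le _)
    _ = ∑ i, #((support b (φ i)).map σ.symm.toEmbedding) := by
      rw [← card_add_sum_card_filter_exists_lt fun i =>
        (support_nonempty_of_norm_eq_one (hunit i)).map]
      simp [mem_map_equiv, and_comm]
    _ = sparsity b φ := by simp only [card_map, sparsity]

end LowerBound

section StdVec

variable {n : ℕ}

theorem stdVec_apply (j : ℕ) (a : Fin n) : stdVec n j a = if (a : ℕ) = j then 1 else 0 := rfl

theorem stdVec_mul_stdVec (j : ℕ) (a b : Fin n) :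
    stdVec n j a * stdVec n j b = if a = b then stdVec n j a else 0 := by
  simp only [stdVec_apply]
  grind

theorem stdVec_eq_basisFun (j : Fin n) : stdVec n j = EuclideanSpace.basisFun (Fin n) ℝ j := by
  ext a
  simp [stdVec_apply, Fin.ext_iff]

theorem norm_stdVec {j : ℕ} (hj : j < n) : ‖stdVec n j‖ = 1 := by
  rw [stdVec_eq_basisFun ⟨j, hj⟩, OrthonormalBasis.norm_eq_one]

theorem norm_smul_stdVec_add_smul_stdVec {α β : ℝ} (hαβ : α ^ 2 + β ^ 2 = 1) {j k : ℕ}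
    (hj : j < n) (hk : k < n) (hjk : j ≠ k) : ‖α • stdVec n j + β • stdVec n k‖ = 1 := by
  have horth : ⟪α • stdVec n j, β • stdVec n k⟫_ℝ = 0 := by
    rw [stdVec_eq_basisFun ⟨j, hj⟩, stdVec_eq_basisFun ⟨k, hk⟩, real_inner_smul_left,
      real_inner_smul_right, OrthonormalBasis.inner_eq_zero _ (by simpa using hjk)]
    simp
  rw [← sq_eq_sq₀ (norm_nonneg _) zero_le_one, norm_add_sq_real, horth, norm_smul, norm_smul,
    norm_stdVec hj, norm_stdVec hk]
  simpa using hαβ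

theorem mem_support_basisFun {v : EuclideanSpace ℝ (Fin n)} {a : Fin n} :
    a ∈ support (EuclideanSpace.basisFun (Fin n) ℝ) v ↔ v a ≠ 0 := by
  rw [mem_support, EuclideanSpace.basisFun_inner]

theorem card_support_stdVec {j : ℕ} (hj : j < n) :
    #(support (EuclideanSpace.basisFun (Fin n) ℝ) (stdVec n j)) = 1 := by
  rw [card_eq_one]
  refine ⟨⟨j, hj⟩, ?_⟩
  ext a
  simp [mem_support_basisFun, stdVec_apply, Fin.ext_iff]

theorem card_support_smul_stdVec_add_smul_stdVec {α β : ℝ} (hα : α ≠ 0) (hβ : β ≠ 0) {j k : ℕ}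
    (hj : j < n) (hk : k < n) (hjk : j ≠ k) :
    #(support (EuclideanSpace.basisFun (Fin n) ℝ) (α • stdVec n j + β • stdVec n k)) = 2 := by
  rw [card_eq_two]
  refine ⟨⟨j, hj⟩, ⟨k, hk⟩, by simpa using hjk, ?_⟩
  ext a
  rw [mem_support_basisFun, PiLp.add_apply, PiLp.smul_apply, PiLp.smul_apply, stdVec_apply,
    stdVec_apply, smul_eq_mul, smul_eq_mul]
  grind

end StdVec

section Written

variable {n : ℕ}

/-- The multiset of the vectors written so far. -/
noncomputable def State.written (s : State n) : Multiset (EuclideanSpace ℝ (Fin n)) :=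
  (Multiset.range s.idx).map s.out

theorem map_range_succ_update {β : Type*} (f : ℕ → β) (m : ℕ) (v : β) :
    (Multiset.range (m + 1)).map (Function.update f m v) = v ::ₘ (Multiset.range m).map f := by
  rw [Multiset.range_succ, Multiset.map_cons, Function.update_self]
  congr 1
  exact Multiset.map_congr rfl fun k hk =>
    Function.update_of_ne (Multiset.mem_range.1 hk).ne _ _

variable {s : State n}

theorem written_body_of_lt (h : s.lam s.row < 1) :
    (body s).written =
      (√(s.lam s.row / 2) • stdVec n s.row + -√(1 - s.lam s.row / 2) • stdVec n (s.row + 1)) ::ₘ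
      (√(s.lam s.row / 2) • stdVec n s.row + √(1 - s.lam s.row / 2) • stdVec n (s.row + 1)) ::ₘ
      s.written := by
  simp only [State.written, body, if_pos h, map_range_succ_update, neg_smul, ← sub_eq_add_neg]

theorem written_body_of_le (h : 1 ≤ s.lam s.row) :
    (body s).written = stdVec n s.row ::ₘ s.written := by
  simp only [State.written, body, if_neg h.not_gt, map_range_succ_update]

theorem card_written : s.written.card = s.idx := by
  simp [State.written]

end Written

section Step

variable {n : ℕ} {s : State n}

theorem step_of_lt_one (hrow : s.row < n) (h : s.lam s.row < 1) :
    step s = { body s with row := s.row + 1 } := by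
  rw [step, if_pos hrow, if_pos (by simp [body, h])]

theorem step_of_eq_one (hrow : s.row < n) (h : s.lam s.row = 1) :
    step s = { body s with row := s.row + 1 } := by
  rw [step, if_pos hrow, if_pos (by simp [body, h])]

theorem step_of_one_lt (hrow : s.row < n) (h : 1 < s.lam s.row) : step s = body s := by
  rw [step, if_pos hrow, if_neg (by simp [body, h.not_gt, sub_eq_zero, h.ne'])]

theorem step_of_le_row (hrow : n ≤ s.row) : step s = s := if_neg hrow.not_gt

end Step

section Invariants

variable {n : ℕ} {lam : Fin n → ℝ} {s : State n}

/-- The written vectors have norm one, and their frame operator is diagonal in the standard basis,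
its eigenvalue at `e_a` being the amount by which the variable `lam_a` has been lowered so far. -/
structure FrameInvariant (lam : Fin n → ℝ) (s : State n) : Prop where
  norm_eq_one : ∀ v ∈ s.written, ‖v‖ = 1
  gram_eq : ∀ a b : Fin n,
    (s.written.map fun v => v a * v b).sum = if a = b then lam a - s.lam a else 0

/-- The rows before the current one are used up, the rows after it are still untouched, and the
current one is not used up. -/
structure RowInvariant (lam : Fin n → ℝ) (s : State n) : Prop where
  row_le : s.row ≤ n
  lam_of_lt : ∀ a : Fin n, a < s.row → s.lam a = 0
  lam_row_pos : s.row < n → 0 < s.lam s.row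
  lam_of_gt : ∀ a : Fin n, s.row < a → s.lam a = lam a

theorem frameInvariant_init (lam : Fin n → ℝ) : FrameInvariant lam (init lam) where
  norm_eq_one := by simp [init, State.written]
  gram_eq := by simp [init, State.written]

theorem rowInvariant_init (hlam : ∀ j, 0 < lam j) : RowInvariant lam (init lam) where
  row_le := n.zero_le
  lam_of_lt := by simp [init]
  lam_row_pos h := by simpa [init, show 0 < n from h] using hlam ⟨0, h⟩
  lam_of_gt := by simp [init]

theorem FrameInvariant.sum_sub_eq (hs : FrameInvariant lam s) :
    ∑ a, (lam a - s.lam a) = s.idx := by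
  calc
    ∑ a, (lam a - s.lam a) = ∑ a, (s.written.map fun v => v a ^ 2).sum :=
      sum_congr rfl fun a _ => by simpa [sq] using (hs.gram_eq a a).symm
    _ = (s.written.map fun _ => (1 : ℝ)).sum := by
      rw [← Multiset.sum_map_sum]
      refine congrArg _ (Multiset.map_congr rfl fun v hv => ?_)
      rw [← EuclideanSpace.real_norm_sq_eq, hs.norm_eq_one v hv, one_pow]
    _ = s.idx := by simp [card_written]

theorem FrameInvariant.body_of_one_le (hs : FrameInvariant lam s) (hrow : s.row < n)
    (h : 1 ≤ s.lam s.row) : FrameInvariant lam (body s) where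
  norm_eq_one := by
    rw [written_body_of_le h]
    exact Multiset.forall_mem_cons.2 ⟨norm_stdVec hrow, hs.norm_eq_one⟩
  gram_eq a b := by
    rw [written_body_of_le h, Multiset.map_cons, Multiset.sum_cons, hs.gram_eq,
      stdVec_mul_stdVec, stdVec_apply]
    simp only [body, if_neg h.not_gt, Function.update_apply]
    grind

theorem sq_sqrt_half_add_sq_sqrt_one_sub_half {x : ℝ} (h₀ : 0 ≤ x) (h₁ : x ≤ 1) :
    √(x / 2) ^ 2 + √(1 - x / 2) ^ 2 = 1 := by
  rw [Real.sq_sqrt (by linarith), Real.sq_sqrt (by linarith)]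
  ring

theorem gram_smul_add_neg_smul_add_gram_smul_add_smul (α β : ℝ) (j k : ℕ) (a b : Fin n) :
    (α • stdVec n j + -β • stdVec n k) a * (α • stdVec n j + -β • stdVec n k) b +
      (α • stdVec n j + β • stdVec n k) a * (α • stdVec n j + β • stdVec n k) b =
    if a = b then 2 * α ^ 2 * stdVec n j a + 2 * β ^ 2 * stdVec n k a else 0 := by
  calc
    _ = 2 * α ^ 2 * (stdVec n j a * stdVec n j b) + 2 * β ^ 2 * (stdVec n k a * stdVec n k b) := by
      simp only [PiLp.add_apply, PiLp.smul_apply, smul_eq_mul]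
      ring
    _ = _ := by
      rw [stdVec_mul_stdVec, stdVec_mul_stdVec]
      split_ifs <;> ring

theorem FrameInvariant.body_of_lt_one (hs : FrameInvariant lam s) (hrow : s.row + 1 < n)
    (hpos : 0 < s.lam s.row) (h : s.lam s.row < 1) : FrameInvariant lam (body s) where
  norm_eq_one := by
    have hsq := sq_sqrt_half_add_sq_sqrt_one_sub_half hpos.le h.le
    rw [written_body_of_lt h]
    refine Multiset.forall_mem_cons.2 ⟨?_, Multiset.forall_mem_cons.2 ⟨?_, hs.norm_eq_one⟩⟩
    · exact norm_smul_stdVec_add_smul_stdVec (by rwa [neg_sq]) (by omega) hrow (by omega)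
    · exact norm_smul_stdVec_add_smul_stdVec hsq (by omega) hrow (by omega)
  gram_eq a b := by
    rw [written_body_of_lt h, Multiset.map_cons, Multiset.sum_cons, Multiset.map_cons,
      Multiset.sum_cons, ← add_assoc, gram_smul_add_neg_smul_add_gram_smul_add_smul, hs.gram_eq,
      Real.sq_sqrt (by linarith), Real.sq_sqrt (by linarith), stdVec_apply, stdVec_apply]
    simp only [body, if_pos h, Function.update_apply]
    grind

theorem RowInvariant.step_of_lt_one (hs : RowInvariant lam s) (hlam : ∀ j, 2 ≤ lam j)
    (hrow : s.row < n) (h : s.lam s.row < 1) : RowInvariant lam (step s) := by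
  have hpos := hs.lam_row_pos hrow
  rw [SpectralTetris.step_of_lt_one hrow h]
  refine ⟨hrow, fun a ha => ?_, fun hrow' => ?_, fun a ha => ?_⟩
  · have := hs.lam_of_lt a
    simp only [body, if_pos h, Function.update_apply] at ha ⊢
    grind
  · have := hs.lam_of_gt ⟨s.row + 1, hrow'⟩ s.row.lt_succ_self
    have := hlam ⟨s.row + 1, hrow'⟩
    simp only [body, if_pos h, Function.update_apply]
    grind
  · have := hs.lam_of_gt a
    simp only [body, if_pos h, Function.update_apply] at ha ⊢
    grind

theorem RowInvariant.step_of_eq_one (hs : RowInvariant lam s) (hlam : ∀ j, 0 < lam j)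
    (hrow : s.row < n) (h : s.lam s.row = 1) : RowInvariant lam (step s) := by
  rw [SpectralTetris.step_of_eq_one hrow h]
  refine ⟨hrow, fun a ha => ?_, fun hrow' => ?_, fun a ha => ?_⟩
  · have := hs.lam_of_lt a
    simp only [body, if_neg h.not_lt, Function.update_apply] at ha ⊢
    grind
  · have := hs.lam_of_gt ⟨s.row + 1, hrow'⟩ s.row.lt_succ_self
    have := hlam ⟨s.row + 1, hrow'⟩
    simp only [body, if_neg h.not_lt, Function.update_apply]
    grind
  · have := hs.lam_of_gt a
    simp only [body, if_neg h.not_lt, Function.update_apply] at ha ⊢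
    grind

theorem RowInvariant.step_of_one_lt (hs : RowInvariant lam s) (hrow : s.row < n)
    (h : 1 < s.lam s.row) : RowInvariant lam (step s) := by
  rw [SpectralTetris.step_of_one_lt hrow h]
  refine ⟨?_, fun a ha => ?_, fun _ => ?_, fun a ha => ?_⟩ <;>
    simp only [body, if_neg h.not_gt, Function.update_apply] at *
  · exact hs.row_le
  · grind [hs.lam_of_lt a]
  · grind
  · grind [hs.lam_of_gt a]

end Invariants

section Correctness

variable {n N : ℕ} {lam : Fin n → ℝ} {s : State n}

/-- The invariant of Spectral Tetris: besides the frame and row invariants, the number of nonzero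
coordinates written so far exceeds the number of vectors by two for each cut row passed. -/
structure Invariant (lam : Fin n → ℝ) (s : State n) : Prop
    extends FrameInvariant lam s, RowInvariant lam s where
  sum_card_support :
    (s.written.map fun v => #(support (EuclideanSpace.basisFun (Fin n) ℝ) v)).sum =
      s.idx + 2 * #{j ∈ cutRows lam | j.val < s.row}

theorem invariant_init (hlam : ∀ j, 0 < lam j) : Invariant lam (init lam) :=
  ⟨frameInvariant_init lam, rowInvariant_init hlam, by simp [init, State.written]⟩

theorem Invariant.sum_Iic_row (hs : Invariant lam s) (hrow : s.row < n) :
    ∑ a ∈ Iic ⟨s.row, hrow⟩, lam a = s.idx + s.lam s.row := by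
  calc
    ∑ a ∈ Iic ⟨s.row, hrow⟩, lam a
        = ∑ a ∈ Iic ⟨s.row, hrow⟩, (lam a - s.lam a) +
          ∑ a ∈ Iic (⟨s.row, hrow⟩ : Fin n), s.lam a := by
      rw [sum_sub_distrib, sub_add_cancel]
    _ = ∑ a, (lam a - s.lam a) + s.lam s.row := by
      congr 1
      · refine sum_subset (subset_univ _) fun a _ ha => sub_eq_zero.2 (hs.lam_of_gt a ?_).symm
        simpa [Fin.lt_def] using ha
      · refine sum_eq_single_of_mem (⟨s.row, hrow⟩ : Fin n) (mem_Iic.2 le_rfl) fun a ha hne => ?_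
        exact hs.lam_of_lt a ((mem_Iic.1 ha).lt_of_ne hne)
    _ = s.idx + s.lam s.row := by rw [hs.sum_sub_eq]

theorem Invariant.row_mem_cutRows (hs : Invariant lam s) (hrow : s.row < n)
    (h : s.lam s.row < 1) : ⟨s.row, hrow⟩ ∈ cutRows lam := by
  rw [mem_cutRows, hs.sum_Iic_row hrow]
  rintro ⟨z, hz⟩
  have hpos := hs.lam_row_pos hrow
  have hgt : (s.idx : ℤ) < z := by exact_mod_cast (by linarith : (s.idx : ℝ) < z)
  have hlt : z < (s.idx : ℤ) + 1 := by exact_mod_cast (by linarith : (z : ℝ) < s.idx + 1)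
  omega

theorem Invariant.row_notMem_cutRows (hs : Invariant lam s) (hrow : s.row < n)
    (h : s.lam s.row = 1) : ⟨s.row, hrow⟩ ∉ cutRows lam := by
  rw [mem_cutRows, hs.sum_Iic_row hrow, h, not_not]
  exact ⟨s.idx + 1, by push_cast; rfl⟩

theorem succ_lt_of_mem_cutRows (hsum : ∑ j, lam j = N) {j : Fin n} (hj : j ∈ cutRows lam) :
    (j : ℕ) + 1 < n := by
  refine lt_of_not_ge fun hle => mem_cutRows.1 hj ⟨N, ?_⟩
  have huniv : Iic j = univ := by
    ext a
    simp only [mem_Iic, Fin.le_def, mem_univ, iff_true]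
    omega
  rw [huniv, hsum, Int.cast_natCast]

theorem card_filter_val_lt_succ (S : Finset (Fin n)) (j : Fin n) :
    #{a ∈ S | a.val < j.val + 1} = #{a ∈ S | a.val < j.val} + if j ∈ S then 1 else 0 := by
  simp only [Nat.lt_succ_iff_lt_or_eq, Fin.val_inj, filter_or]
  have hdisj : Disjoint {a ∈ S | a.val < j.val} {a ∈ S | a = j} :=
    disjoint_filter.2 fun _ _ => Fin.ne_of_lt
  rw [card_union_of_disjoint hdisj, filter_eq', apply_ite card, card_singleton, card_empty]

theorem Invariant.step_of_lt_one (hs : Invariant lam s) (hlam : ∀ j, 2 ≤ lam j)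
    (hsum : ∑ j, lam j = N) (hrow : s.row < n) (h : s.lam s.row < 1) :
    Invariant lam (step s) := by
  have hcut := hs.row_mem_cutRows hrow h
  have hnext : s.row + 1 < n := succ_lt_of_mem_cutRows hsum hcut
  have hpos := hs.lam_row_pos hrow
  obtain ⟨hnorm, hgram⟩ := hs.toFrameInvariant.body_of_lt_one hnext hpos h
  have hrows := hs.toRowInvariant.step_of_lt_one hlam hrow h
  rw [SpectralTetris.step_of_lt_one hrow h] at hrows ⊢
  refine ⟨⟨hnorm, hgram⟩, hrows, ?_⟩
  have hα : √(s.lam s.row / 2) ≠ 0 := (Real.sqrt_pos.2 (by linarith)).ne'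
  have hβ : √(1 - s.lam s.row / 2) ≠ 0 := (Real.sqrt_pos.2 (by linarith)).ne'
  change ((body s).written.map _).sum =
    (body s).idx + 2 * #{j ∈ cutRows lam | j.val < s.row + 1}
  rw [written_body_of_lt h, Multiset.map_cons, Multiset.map_cons, Multiset.sum_cons,
    Multiset.sum_cons, hs.sum_card_support,
    card_support_smul_stdVec_add_smul_stdVec hα (neg_ne_zero.2 hβ) hrow hnext (by omega),
    card_support_smul_stdVec_add_smul_stdVec hα hβ hrow hnext (by omega),
    card_filter_val_lt_succ _ ⟨s.row, hrow⟩, if_pos hcut]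
  simp only [body, if_pos h]
  ring

theorem Invariant.step_of_eq_one (hs : Invariant lam s) (hlam : ∀ j, 0 < lam j)
    (hrow : s.row < n) (h : s.lam s.row = 1) : Invariant lam (step s) := by
  obtain ⟨hnorm, hgram⟩ := hs.toFrameInvariant.body_of_one_le hrow h.ge
  have hrows := hs.toRowInvariant.step_of_eq_one hlam hrow h
  rw [SpectralTetris.step_of_eq_one hrow h] at hrows ⊢
  refine ⟨⟨hnorm, hgram⟩, hrows, ?_⟩
  change ((body s).written.map _).sum =
    (body s).idx + 2 * #{j ∈ cutRows lam | j.val < s.row + 1}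
  rw [written_body_of_le h.ge, Multiset.map_cons, Multiset.sum_cons, hs.sum_card_support,
    card_support_stdVec hrow, card_filter_val_lt_succ _ ⟨s.row, hrow⟩,
    if_neg (hs.row_notMem_cutRows hrow h)]
  simp only [body, if_neg h.not_lt]
  ring

theorem Invariant.step_of_one_lt (hs : Invariant lam s) (hrow : s.row < n)
    (h : 1 < s.lam s.row) : Invariant lam (step s) := by
  have hframe := hs.toFrameInvariant.body_of_one_le hrow h.le
  have hrows := hs.toRowInvariant.step_of_one_lt hrow h
  rw [SpectralTetris.step_of_one_lt hrow h] at hrows ⊢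
  refine ⟨hframe, hrows, ?_⟩
  rw [written_body_of_le h.le, Multiset.map_cons, Multiset.sum_cons, hs.sum_card_support,
    card_support_stdVec hrow]
  simp only [body, if_neg h.not_gt]
  ring

theorem Invariant.step (hs : Invariant lam s) (hlam : ∀ j, 2 ≤ lam j)
    (hsum : ∑ j, lam j = N) : Invariant lam (step s) := by
  rcases le_or_gt n s.row with hdone | hrow
  · rwa [step_of_le_row hdone]
  · rcases lt_trichotomy (s.lam s.row) 1 with h | h | h
    · exact hs.step_of_lt_one hlam hsum hrow h
    · exact hs.step_of_eq_one (fun j => two_pos.trans_le (hlam j)) hrow h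
    · exact hs.step_of_one_lt hrow h

theorem invariant_finalState (hlam : ∀ j, 2 ≤ lam j) (hsum : ∑ j, lam j = N) (t : ℕ) :
    Invariant lam (finalState t lam) :=
  Function.Iterate.rec (Invariant lam) (invariant_init fun j => two_pos.trans_le (hlam j))
    (fun _ hs => hs.step hlam hsum) t

theorem row_le_row_step (s : State n) : s.row ≤ (SpectralTetris.step s).row := by
  unfold SpectralTetris.step body
  split_ifs <;> simp

theorem idx_lt_idx_step (hrow : s.row < n) : s.idx < (SpectralTetris.step s).idx := by
  unfold SpectralTetris.step body
  split_ifs <;> simp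

theorem le_idx_iterate_step (s : State n) {t : ℕ} (hrow : (SpectralTetris.step^[t] s).row < n) :
    t ≤ (SpectralTetris.step^[t] s).idx := by
  induction t with
  | zero => exact Nat.zero_le _
  | succ t ih =>
    rw [Function.iterate_succ_apply'] at hrow ⊢
    have hprev := (row_le_row_step _).trans_lt hrow
    exact (ih hprev).trans_lt (idx_lt_idx_step hprev)

theorem row_finalState (hlam : ∀ j, 2 ≤ lam j) (hsum : ∑ j, lam j = N) :
    (finalState N lam).row = n := by
  have hs := invariant_finalState hlam hsum N
  refine hs.row_le.eq_of_not_lt fun hrow => ?_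
  have hidx : (N : ℝ) ≤ (finalState N lam).idx :=
    Nat.cast_le.2 (le_idx_iterate_step (init lam) hrow)
  have hle : ∑ a ∈ Iic ⟨(finalState N lam).row, hrow⟩, lam a ≤ N := by
    rw [← hsum]
    exact sum_le_univ_sum_of_nonneg fun j => zero_le_two.trans (hlam j)
  linarith [hs.sum_Iic_row hrow, hs.lam_row_pos hrow]

theorem lam_finalState (hlam : ∀ j, 2 ≤ lam j) (hsum : ∑ j, lam j = N) (a : Fin n) :
    (finalState N lam).lam a = 0 :=
  (invariant_finalState hlam hsum N).lam_of_lt a (by rw [row_finalState hlam hsum]; exact a.2)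

theorem terminates_of_two_le (hlam : ∀ j, 2 ≤ lam j) (hsum : ∑ j, lam j = N) :
    Terminates N lam := by
  refine ⟨row_finalState hlam hsum, ?_⟩
  have htrace := (invariant_finalState hlam hsum N).sum_sub_eq
  simp only [lam_finalState hlam hsum, sub_zero, hsum] at htrace
  exact_mod_cast htrace.symm

theorem map_STF (h : Terminates N lam) :
    Multiset.map (STF N lam) univ.val = (finalState N lam).written := by
  rw [State.written, h.2, ← range_val, ← Nat.Iio_eq_range, ← Fin.map_valEmbedding_univ, map_val,
    Multiset.map_map]
  rfl

theorem STF_mem_eigenbasisFrames (hlam : ∀ j, 2 ≤ lam j) (hsum : ∑ j, lam j = N) :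
    STF N lam ∈ eigenbasisFrames (EuclideanSpace.basisFun (Fin n) ℝ) N lam := by
  have hs := invariant_finalState hlam hsum N
  have hwritten := map_STF (terminates_of_two_le hlam hsum)
  have hunit : IsUnitNorm (STF N lam) := fun i =>
    hs.norm_eq_one _ (hwritten ▸ Multiset.mem_map_of_mem _ (mem_univ_val i))
  have hdiag : ∀ j, frameOperator (STF N lam) (EuclideanSpace.basisFun (Fin n) ℝ j) =
      lam j • EuclideanSpace.basisFun (Fin n) ℝ j := by
    refine frameOperator_apply_basis_iff.2 fun j k => ?_
    have hgram := hs.gram_eq j k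
    rw [← hwritten, Multiset.map_map, lam_finalState hlam hsum, sub_zero] at hgram
    simp only [EuclideanSpace.basisFun_inner]
    exact hgram
  exact ⟨(isFrame_iff_eigenvalues_pos hdiag).2 fun j => two_pos.trans_le (hlam j), hunit, hdiag⟩

theorem sparsity_STF (hlam : ∀ j, 2 ≤ lam j) (hsum : ∑ j, lam j = N) :
    sparsity (EuclideanSpace.basisFun (Fin n) ℝ) (STF N lam) =
      N + 2 * (n - integerPartialSums lam) := by
  have hterm := terminates_of_two_le hlam hsum
  have hcount := (invariant_finalState hlam hsum N).sum_card_support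
  rw [← map_STF hterm, Multiset.map_map, hterm.1, hterm.2,
    filter_true_of_mem fun j _ => j.2, card_cutRows fun j => two_pos.trans_le (hlam j)] at hcount
  exact hcount

theorem sparsity_STF_le (hlam : ∀ j, 2 ≤ lam j) (hsum : ∑ j, lam j = N)
    (hblock : OrderedBlockwise lam) {φ : Fin N → EuclideanSpace ℝ (Fin n)}
    (hφ : φ ∈ eigenbasisFrames (EuclideanSpace.basisFun (Fin n) ℝ) N lam) :
    sparsity (EuclideanSpace.basisFun (Fin n) ℝ) (STF N lam) ≤
      sparsity (EuclideanSpace.basisFun (Fin n) ℝ) φ := by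
  rw [sparsity_STF hlam hsum, ← hblock.maximalBlockNumber_eq]
  exact add_two_mul_sub_maximalBlockNumber_le_sparsity hφ

theorem isOptimallySparse_STF (hlam : ∀ j, 2 ≤ lam j) (hsum : ∑ j, lam j = N)
    (hblock : OrderedBlockwise lam) :
    IsOptimallySparse (EuclideanSpace.basisFun (Fin n) ℝ)
      (eigenbasisFrames (EuclideanSpace.basisFun (Fin n) ℝ) N lam) (STF N lam) :=
  isOptimallySparse_of_forall_sparsity_le _ (STF_mem_eigenbasisFrames hlam hsum) fun _ hφ =>
    sparsity_STF_le hlam hsum hblock hφ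

end Correctness

end SpectralTetris

theorem mainTheorem4 (n N : ℕ) (hn : 0 < n) (hN : 2 * n ≤ N) :
    SpectralTetris.Terminates N (fun _ : Fin n => (N : ℝ) / n) ∧
    SpectralTetris.STF N (fun _ : Fin n => (N : ℝ) / n) ∈
      SpectralTetris.unitNormTightFrames n N ∧
    SpectralTetris.IsOptimallySparse (EuclideanSpace.basisFun (Fin n) ℝ)
      (SpectralTetris.unitNormTightFrames n N)
      (SpectralTetris.STF N (fun _ : Fin n => (N : ℝ) / n)) ∧
    SpectralTetris.IsOptimallySparse (EuclideanSpace.basisFun (Fin n) ℝ)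
      (SpectralTetris.frameClass N (fun _ : Fin n => (N : ℝ) / n))
      (SpectralTetris.STF N (fun _ : Fin n => (N : ℝ) / n)) ∧
    IsLeast {k : ℕ | SpectralTetris.IsSparse (EuclideanSpace.basisFun (Fin n) ℝ) k
      (SpectralTetris.STF N (fun _ : Fin n => (N : ℝ) / n))} (N + 2 * (n - Nat.gcd N n)) ∧
    SpectralTetris.maximalBlockNumber (fun _ : Fin n => (N : ℝ) / n) = Nat.gcd N n := by
  have hn0 : (0 : ℝ) < n := Nat.cast_pos.2 hn
  have hlam : ∀ _ : Fin n, 2 ≤ (N : ℝ) / n := fun _ => by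
    rw [le_div_iff₀ hn0]
    exact_mod_cast hN
  have hsum : ∑ _j : Fin n, (N : ℝ) / n = N := by
    rw [Finset.sum_const, Finset.card_univ, Fintype.card_fin, nsmul_eq_mul,
      mul_div_cancel₀ _ hn0.ne']
  have hblock := SpectralTetris.orderedBlockwise_const (n := n) ((N : ℝ) / n)
  have hpartial := SpectralTetris.integerPartialSums_const (N := N) hn.ne' (by omega)
  have hopt := SpectralTetris.isOptimallySparse_STF hlam hsum hblock
  rw [SpectralTetris.unitNormTightFrames_eq_eigenbasisFrames hn.ne' (EuclideanSpace.basisFun _ ℝ),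
    SpectralTetris.frameClass_const (EuclideanSpace.basisFun _ ℝ), ← hpartial,
    ← SpectralTetris.sparsity_STF hlam hsum]
  exact ⟨SpectralTetris.terminates_of_two_le hlam hsum, hopt.1, hopt, hopt,
    SpectralTetris.isLeast_sparsity _ _, hblock.maximalBlockNumber_eq⟩
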